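/- Let $M$ be a closed surface (compact, without boundary; connectedness and orientability are not needed) with a finite simplicial triangulation $\mathcal T=(V,E,F)$, $V\neq\emptyset$, and let $\Phi:E\to[0,\pi/2]$ be a weight on the edges. A circle packing metric is a function $r:V\to(0,\infty)$. It gives the edge $\{i,j\}$ the length $l_{ij}=\sqrt{r_i^2+r_j^2+2r_ir_j\cos\Phi_{ij}}$, and $\theta_i^{jk}$ denotes the inner angle at $i$ of the Euclidean triangle with side lengths $l_{ij},l_{ik},l_{jk}$, for $\{i,j,k\}\in F$. Put $$K_i=2\pi-\sum_{\{i,j,k\}\in F}\theta_i^{jk},\qquad R_i=\frac{K_i}{r_i^2},\qquad R_{av}=\frac{2\pi\chi(M)}{\sum_{i\in V}r_i^2},$$ where the first sum is over the triangles having $i$ as a vertex and $\chi(M)=|V|-|E|+|F|$. The normalized combinatorial Ricci flow is the system $$\frac{d(r_i^2)}{dt}=(R_{av}-R_i)\,r_i^2,\qquad i\in V.$$ Theorem. Let $r(0)$ be a circle packing metric with $R_i(0)<0$ for all $i\in V$. Then there is a circle packing metric $r^*$ with negative constant $R$-curvature, that is, $R_i(r^*)=c$ for all $i\in V$ with a constant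 $c<0$. Furthermore, the normalized combinatorial Ricci flow with initial metric $r(0)$ has a solution $r(t)$ that exists for all $t\ge 0$; it is the unique one (every solution with the same initial metric on an interval $[0,T)$ agrees with it there); and it converges exponentially fast to $r^*$: there are constants $C,a>0$ with $\|r(t)-r^*\|\le Ce^{-at}$ for all $t\ge 0$. -/

import Mathlib

open scoped Classical in
/-- The link of the vertex `v` in a two-dimensional simplicial complex, as a graph: its vertices are
the neighbours `w` of `v`, and `a`, `b` are joined when `v, a, b` span a triangle. -/
def AbstractSimplicialComplex.linkGraph {V : Type*} (K : AbstractSimplicialComplex V) (v : V) :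
    SimpleGraph {w : V // w ≠ v ∧ ({v, w} : Finset V) ∈ K.faces} where
  Adj a b := a ≠ b ∧ ({v, a.1, b.1} : Finset V) ∈ K.faces
  symm := ⟨fun a b h => ⟨h.1.symm, by
    have h2 := h.2
    rwa [Finset.pair_comm a.1 b.1] at h2⟩⟩
  loopless := ⟨fun _ h => h.1 rfl⟩

/-- A triangulated closed surface with vertex set `V` (used with `V` finite): a pure two-dimensional
abstract simplicial complex in which every edge lies in exactly two triangles and the link of every
vertex is connected (so that the link of every vertex is a circle). No connectedness or
orientability of the surface is required. -/
structure TriangulatedSurface (V : Type*) extends AbstractSimplicialComplex V where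
  card_le_three : ∀ s ∈ faces, s.card ≤ 3
  exists_triangle : ∀ s ∈ faces, ∃ t ∈ faces, s ⊆ t ∧ t.card = 3
  edge_two_triangles : ∀ e ∈ faces, e.card = 2 → {t ∈ faces | t.card = 3 ∧ e ⊆ t}.ncard = 2
  link_connected : ∀ v : V, (toAbstractSimplicialComplex.linkGraph v).Connected

/-- A weighted triangulated surface: every edge `e = {i, j}` carries a weight
`Φ e ∈ [0, π / 2]`. (The values of `Φ` at finite sets that are not edges are never used.) -/
structure WeightedTriangulatedSurface (V : Type*) extends TriangulatedSurface V where
  Φ : Finset V → ℝ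
  Φ_mem : ∀ e ∈ faces, e.card = 2 → Φ e ∈ Set.Icc 0 (Real.pi / 2)

namespace TriangulatedSurface

variable {V : Type*} [Fintype V]

open scoped Classical in
/-- The finite set `E` of edges. -/
noncomputable def edges (M : TriangulatedSurface V) : Finset (Finset V) :=
  {s | s ∈ M.faces ∧ s.card = 2}

open scoped Classical in
/-- The finite set `F` of triangles. -/
noncomputable def triangles (M : TriangulatedSurface V) : Finset (Finset V) :=
  {s | s ∈ M.faces ∧ s.card = 3}

/-- The Euler characteristic `χ(M) = |V| - |E| + |F|`. -/
noncomputable def eulerChar (M : TriangulatedSurface V) : ℤ :=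
  (Fintype.card V : ℤ) - (M.edges.card : ℤ) + (M.triangles.card : ℤ)

end TriangulatedSurface

namespace WeightedTriangulatedSurface

variable {V : Type*}

open scoped Classical in
/-- The length `l_ij = √(r_i² + r_j² + 2 r_i r_j cos Φ_ij)` of the edge `{i, j}`. -/
noncomputable def edgeLength (M : WeightedTriangulatedSurface V) (r : V → ℝ) (i j : V) : ℝ :=
  Real.sqrt (r i ^ 2 + r j ^ 2 + 2 * r i * r j * Real.cos (M.Φ {i, j}))

/-- The inner angle `θ_i^{jk}` at `i` of the Euclidean triangle with side lengths
`l_ij, l_ik, l_jk` (by the law of cosines). -/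
noncomputable def angle (M : WeightedTriangulatedSurface V) (r : V → ℝ) (i j k : V) : ℝ :=
  Real.arccos
    ((M.edgeLength r i j ^ 2 + M.edgeLength r i k ^ 2 - M.edgeLength r j k ^ 2) /
      (2 * M.edgeLength r i j * M.edgeLength r i k))

variable [Fintype V]

open scoped Classical in
/-- The angle deficit `K_i = 2π - ∑ θ_i^{jk}` over the triangles `{i, j, k}` at `i`. The sum runs
over ordered pairs `(j, k)`, which meets every triangle twice, hence the factor `1 / 2`. -/
noncomputable def gaussCurv (M : WeightedTriangulatedSurface V) (r : V → ℝ) (i : V) : ℝ :=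
  2 * Real.pi -
    (1 / 2) * ∑ j : V, ∑ k : V,
      if ({i, j, k} : Finset V) ∈ M.triangles then M.angle r i j k else 0

/-- The `R`-curvature `R_i = K_i / r_i²`. -/
noncomputable def rCurv (M : WeightedTriangulatedSurface V) (r : V → ℝ) (i : V) : ℝ :=
  M.gaussCurv r i / r i ^ 2

/-- The average curvature `R_av = 2π χ(M) / ‖r‖²`, with `‖r‖² = ∑ r_i²`. -/
noncomputable def rAv (M : WeightedTriangulatedSurface V) (r : V → ℝ) : ℝ :=
  2 * Real.pi * (M.eulerChar : ℝ) / ∑ i : V, r i ^ 2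

/-- `r` is a solution on the time interval `I` of the normalized combinatorial Ricci flow
`dg_i/dt = (R_av - R_i) g_i`, where `g_i = r_i²`, through circle packing metrics
(derivatives are one-sided at the end points of `I`). -/
def IsNormalizedRicciFlowOn (M : WeightedTriangulatedSurface V) (r : ℝ → V → ℝ) (I : Set ℝ) :
    Prop :=
  ∀ t ∈ I, ∀ i : V, 0 < r t i ∧
    HasDerivWithinAt (fun s => r s i ^ 2) ((M.rAv (r t) - M.rCurv (r t) i) * r t i ^ 2) I t

end WeightedTriangulatedSurface

/-! Write `u = log r`. The flow becomes `u_i' = (c - R_i)/2` with `c = R_av`, and only four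
properties of the angle deficit `K` matter (`IsCurvatureMap`): it is `C¹`, `K_i` does not increase
when the other radii grow, `K` is invariant under scaling, and `∑ K_i` is a constant (Gauss–Bonnet).
The geometric input is that an angle of a three-circle configuration grows with the two opposite
radii; this uses cosines of the weights in `[0, 1]`.

Gauss–Bonnet makes the total area `∑ r_i²` constant along the flow, so `c` is constant. The
curvature obeys `R_i' = dK(u')_i / r_i² + R_i (R_i - c)`. Where `R_i` is maximal, `u'` is minimal at
`i`, and monotonicity with scale invariance gives `dK(u')_i ≤ 0`; at a minimum the sign is reversed.
Since the curvature stays negative, the reaction term pulls `R_i` towards `c` at an exponential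
rate. Comparison with exponential barriers (`exists_abs_avgDensity_sub_le`) gives `|R_i - c| ≤ A
e^{-at}`.

The velocity of `u` is thus exponentially small, so `u` travels a bounded distance. It stays in a
fixed ball, where a truncated, globally solvable field agrees with the true one; this gives
existence for all time. It is also Cauchy, and at its limit all `R_i` equal `c`, which is negative
because it is a weighted mean of the initial curvatures. The limit metric is obtained from the flow
itself, with no separate existence argument. -/

open Set Filter Topology

/-! ### Barriers, global integral curves and exponential convergence. -/

/-- A finite family of functions that starts below a barrier stays below it, provided that a member
of the family which touches the barrier while all the others are below it has the smaller
derivative. -/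
theorem forall_le_of_deriv_lt_of_touching {ι : Type*} [Finite ι] {f f' : ι → ℝ → ℝ} {B B' : ℝ → ℝ}
    {T : ℝ}
    (hf : ∀ i, ∀ t ∈ Icc 0 T, HasDerivWithinAt (f i) (f' i t) (Icc 0 T) t)
    (hB : ∀ t, HasDerivAt B (B' t) t) (h0 : ∀ i, f i 0 ≤ B 0)
    (htouch : ∀ t ∈ Icc 0 T, ∀ i, f i t = B t → (∀ j, f j t ≤ B t) → f' i t < B' t) :
    ∀ t ∈ Icc 0 T, ∀ i, f i t ≤ B t := by
  have hBc : Continuous B := continuous_iff_continuousAt.2 fun t => (hB t).continuousAt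
  have hfc : ∀ i, ContinuousOn (f i) (Icc 0 T) := fun i t ht => (hf i t ht).continuousWithinAt
  have hclosed : IsClosed ({t | ∀ i, f i t ≤ B t} ∩ Icc 0 T) := by
    have : {t | ∀ i, f i t ≤ B t} ∩ Icc 0 T =
        Icc 0 T ∩ ⋂ i : ι, {t ∈ Icc 0 T | f i t ≤ B t} := by
      ext t
      simp only [mem_inter_iff, mem_ofPred_eq, mem_iInter]
      exact ⟨fun h => ⟨h.2, fun i => ⟨h.2, h.1 i⟩⟩, fun h => ⟨fun i => (h.2 i).2, h.1⟩⟩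
    rw [this]
    exact isClosed_Icc.inter
      (isClosed_iInter fun i => isClosed_Icc.isClosed_le (hfc i) hBc.continuousOn)
  -- Continuous induction: the closed set of good times contains `0` and, with each of its points
  -- before `T`, a right neighbourhood of that point.
  have key := hclosed.Icc_subset_of_forall_mem_nhdsWithin (a := 0) (b := T) h0 ?_
  · exact fun t ht => key ht
  rintro t ⟨ht, htT⟩
  have htI : t ∈ Icc 0 T := Ico_subset_Icc_self htT
  have hn : Icc 0 T ∈ 𝓝[>] t := by
    exact mem_of_superset (Ioc_mem_nhdsGT htT.2) fun s hs => ⟨htT.1.trans hs.1.le, hs.2⟩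
  change ∀ᶠ s in 𝓝[>] t, ∀ i, f i s ≤ B s
  rw [eventually_all]
  intro i
  have hder : HasDerivWithinAt (fun s => B s - f i s) (B' t - f' i t) (Ioi t) t :=
    ((hB t).hasDerivWithinAt.sub (hf i t htI)).mono_of_mem_nhdsWithin hn
  rcases (ht i).lt_or_eq with hlt | heq
  · have := hder.continuousWithinAt.eventually (lt_mem_nhds (sub_pos.2 hlt))
    filter_upwards [this] with s hs using (sub_pos.1 hs).le
  · have hpos : 0 < B' t - f' i t := sub_pos.2 (htouch t htI i heq ht)
    have hs := (hasDerivWithinAt_iff_tendsto_slope' (by simp)).1 hder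
    filter_upwards [hs.eventually (lt_mem_nhds hpos), self_mem_nhdsWithin] with s hs hts
    rw [slope_def_field, heq, sub_self, sub_zero] at hs
    have h1 : 0 < s - t := sub_pos.2 hts
    have := mul_pos hs h1
    rw [div_mul_cancel₀ _ h1.ne'] at this
    linarith

/-- A bounded Lipschitz vector field has integral curves for all nonnegative times. -/
theorem LipschitzWith.exists_forall_hasDerivWithinAt_Ici {E : Type*} [NormedAddCommGroup E]
    [NormedSpace ℝ E] [CompleteSpace E] {X : E → E} {K L : NNReal} (hX : LipschitzWith K X)
    (hL : ∀ x, ‖X x‖ ≤ L) (x₀ : E) :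
    ∃ u : ℝ → E, u 0 = x₀ ∧ ∀ t ∈ Ici (0 : ℝ), HasDerivWithinAt u (X (u t)) (Ici 0) t := by
  have hex : ∀ n : ℕ, ∃ w : ℝ → E, w 0 = x₀ ∧
      ∀ t ∈ Icc (0 : ℝ) (n + 1), HasDerivWithinAt w (X (w t)) (Icc 0 (n + 1)) t := by
    intro n
    have hn : (0 : ℝ) ≤ n + 1 := by positivity
    have : IsPicardLindelof (fun _ => X) (⟨0, le_rfl, hn⟩ : Icc (0 : ℝ) (n + 1)) x₀
        (L * (n + 1)) 0 L K :=
      { lipschitzOnWith := fun _ _ => hX.lipschitzOnWith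
        continuousOn := fun _ _ => continuousOn_const
        norm_le := fun _ _ x _ => hL x
        mul_max_le := by simp [hn] }
    exact this.exists_eq_forall_mem_Icc_hasDerivWithinAt₀
  choose w hw0 hw using hex
  have hr : ∀ n : ℕ, ∀ b ≤ (n + 1 : ℝ), ∀ t ∈ Ico 0 b,
      HasDerivWithinAt (w n) (X (w n t)) (Ici t) t :=
    fun n b hb t ht => (hw n t ⟨ht.1, ht.2.le.trans hb⟩).mono_of_mem_nhdsWithin <|
      mem_of_superset (Ico_mem_nhdsGE (ht.2.trans_le hb)) fun s hs => ⟨ht.1.trans hs.1, hs.2.le⟩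
  have hc : ∀ n : ℕ, ∀ b ≤ (n + 1 : ℝ), ContinuousOn (w n) (Icc 0 b) := fun n b hb t ht =>
    (hw n t ⟨ht.1, ht.2.trans hb⟩).continuousWithinAt.mono (Icc_subset_Icc_right hb)
  have hagree : ∀ m n : ℕ, ∀ t : ℝ, 0 ≤ t → t ≤ m + 1 → t ≤ n + 1 → w m t = w n t := by
    intro m n t h0 hm hn
    exact ODE_solution_unique (v := fun _ => X) (K := K) (fun _ => hX) (hc m t hm) (hr m t hm)
      (hc n t hn) (hr n t hn) (by rw [hw0, hw0]) ⟨h0, le_rfl⟩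
  -- The solution `w n` lives on `[0, n + 1]`, so `w ⌈t⌉₊` still solves the equation a little beyond
  -- `t`; near `t` the glued curve equals it by uniqueness.
  refine ⟨fun t => w ⌈t⌉₊ t, by simp [hw0], fun t ht => ?_⟩
  have h1 : t < ⌈t⌉₊ + 1 := (Nat.le_ceil t).trans_lt (lt_add_one _)
  have h2 : HasDerivWithinAt (w ⌈t⌉₊) (X (w ⌈t⌉₊ t)) (Ici 0) t :=
    (hw ⌈t⌉₊ t ⟨ht, h1.le⟩).mono_of_mem_nhdsWithin <| by
      rw [mem_nhdsWithin]
      exact ⟨Iio (⌈t⌉₊ + 1), isOpen_Iio, h1, fun s hs => ⟨hs.2, hs.1.le⟩⟩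
  refine h2.congr_of_eventuallyEq ?_ rfl
  filter_upwards [self_mem_nhdsWithin, mem_nhdsWithin_of_mem_nhds (Iio_mem_nhds h1)] with s hs hst
  exact hagree _ _ s hs ((Nat.le_ceil s).trans (lt_add_one _).le) (le_of_lt hst)

/-- Integral curves of a `C¹` vector field are unique. -/
theorem ContDiff.eqOn_Icc_of_hasDerivWithinAt {E : Type*} [NormedAddCommGroup E]
    [NormedSpace ℝ E] {X : E → E} (hX : ContDiff ℝ 1 X) {T : ℝ} {u v : ℝ → E}
    (hu : ∀ t ∈ Icc 0 T, HasDerivWithinAt u (X (u t)) (Icc 0 T) t)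
    (hv : ∀ t ∈ Icc 0 T, HasDerivWithinAt v (X (v t)) (Icc 0 T) t) (h0 : u 0 = v 0) :
    EqOn u v (Icc 0 T) := by
  have huc : ContinuousOn u (Icc 0 T) := fun t ht => (hu t ht).continuousWithinAt
  have hvc : ContinuousOn v (Icc 0 T) := fun t ht => (hv t ht).continuousWithinAt
  obtain ⟨K, hK⟩ := LocallyLipschitzOn.exists_lipschitzOnWith_of_compact
    ((isCompact_Icc.image_of_continuousOn huc).union (isCompact_Icc.image_of_continuousOn hvc))
    hX.locallyLipschitz.locallyLipschitzOn
  have hr : ∀ {w : ℝ → E}, (∀ t ∈ Icc 0 T, HasDerivWithinAt w (X (w t)) (Icc 0 T) t) →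
      ∀ t ∈ Ico 0 T, HasDerivWithinAt w (X (w t)) (Ici t) t := fun hw t ht =>
    (hw t ⟨ht.1, ht.2.le⟩).mono_of_mem_nhdsWithin <|
      mem_of_superset (Ico_mem_nhdsGE ht.2) fun s hs => ⟨ht.1.trans hs.1, hs.2.le⟩
  exact ODE_solution_unique_of_mem_Icc_right (v := fun _ => X)
    (s := fun _ => u '' Icc 0 T ∪ v '' Icc 0 T) (K := K) (fun _ _ => hK)
    huc (hr hu) (fun t ht => Or.inl ⟨t, Ico_subset_Icc_self ht, rfl⟩)
    hvc (hr hv) (fun t ht => Or.inr ⟨t, Ico_subset_Icc_self ht, rfl⟩) h0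

/-- A curve whose velocity decays exponentially moves exponentially little. -/
theorem norm_sub_le_of_norm_deriv_le_exp {E : Type*} [NormedAddCommGroup E] [NormedSpace ℝ E]
    {u u' : ℝ → E} {A a : ℝ} (ha : 0 < a) {s t : ℝ} (hst : s ≤ t)
    (hu : ∀ x ∈ Icc s t, HasDerivWithinAt u (u' x) (Icc s t) x)
    (hb : ∀ x ∈ Icc s t, ‖u' x‖ ≤ A * Real.exp (-a * x)) :
    ‖u t - u s‖ ≤ A / a * (Real.exp (-a * s) - Real.exp (-a * t)) := by
  refine image_norm_le_of_norm_deriv_right_le_deriv_boundary (f := fun x => u x - u s)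
    (a := s) (b := t) (f' := u') (B := fun x => A / a * (Real.exp (-a * s) - Real.exp (-a * x)))
    (B' := fun x => A * Real.exp (-a * x)) ?_ ?_ (by simp) ?_ ?_ ⟨hst, le_rfl⟩
  · exact fun x hx => ((hu x hx).sub_const _).continuousWithinAt
  · intro x hx
    exact ((hu x ⟨hx.1, hx.2.le⟩).sub_const _).mono_of_mem_nhdsWithin <|
      mem_of_superset (Ico_mem_nhdsGE hx.2) fun y hy => ⟨hx.1.trans hy.1, hy.2.le⟩
  · intro x
    have h1 : HasDerivAt (fun x => Real.exp (-a * x)) (Real.exp (-a * x) * (-a * 1)) x :=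
      ((hasDerivAt_id x).const_mul (-a)).exp
    have h2 : A * Real.exp (-a * x) = A / a * -(Real.exp (-a * x) * (-a * 1)) := by field_simp
    rw [h2]
    exact (h1.const_sub (Real.exp (-a * s))).const_mul (A / a)
  · exact fun x hx => hb x ⟨hx.1, hx.2.le⟩

/-- A curve in a complete space whose oscillation after time `s` is exponentially small in `s`
converges exponentially fast. -/
theorem exists_forall_norm_sub_le_exp {E : Type*} [NormedAddCommGroup E] [CompleteSpace E]
    {u : ℝ → E} {C a : ℝ} (ha : 0 < a)
    (hu : ∀ s t, 0 ≤ s → s ≤ t → ‖u t - u s‖ ≤ C * Real.exp (-a * s)) :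
    ∃ x, ∀ t, 0 ≤ t → ‖u t - x‖ ≤ C * Real.exp (-a * t) := by
  have hlim : Tendsto (fun n : ℕ => C * Real.exp (-a * n)) atTop (𝓝 0) := by
    have h : Tendsto (fun n : ℕ => a * (n : ℝ)) atTop atTop :=
      tendsto_natCast_atTop_atTop.const_mul_atTop ha
    simpa using (Real.tendsto_exp_neg_atTop_nhds_zero.comp h).const_mul C
  have hc : CauchySeq fun n : ℕ => u n := by
    refine cauchySeq_of_le_tendsto_0' _ (fun n m hnm => ?_) hlim
    rw [dist_comm, dist_eq_norm]
    exact hu n m n.cast_nonneg (Nat.cast_le.2 hnm)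
  obtain ⟨x, hx⟩ := cauchySeq_tendsto_of_complete hc
  refine ⟨x, fun t ht => ?_⟩
  have h1 : Tendsto (fun n : ℕ => ‖u t - u n‖) atTop (𝓝 ‖u t - x‖) := (hx.const_sub _).norm
  refine le_of_tendsto h1 ?_
  filter_upwards [eventually_ge_atTop ⌈t⌉₊] with n hn
  rw [norm_sub_rev]
  exact hu t n ht (Nat.ceil_le.1 hn)

/-- Truncating the coordinates to the sup-norm ball of radius `L` around `x₀`. -/
def piClamp {ι : Type*} (x₀ : ι → ℝ) (L : ℝ) (x : ι → ℝ) : ι → ℝ :=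
  fun i => max (x₀ i - L) (min (x₀ i + L) (x i))

section piClamp

variable {ι : Type*} [Fintype ι] (x₀ : ι → ℝ) {L : ℝ}

theorem lipschitzWith_piClamp : LipschitzWith 1 (piClamp x₀ L) := by
  refine LipschitzWith.of_dist_le_mul fun x y => ?_
  rw [NNReal.coe_one, one_mul, dist_pi_le_iff dist_nonneg]
  intro i
  refine le_trans ?_ (dist_le_pi_dist x y i)
  rw [Real.dist_eq, Real.dist_eq]
  refine (abs_max_sub_max_le_max _ _ _ _).trans (max_le (by simp) ?_)
  exact (abs_min_sub_min_le_max _ _ _ _).trans (max_le (by simp) le_rfl)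

theorem piClamp_mem_closedBall (hL : 0 ≤ L) (x : ι → ℝ) :
    piClamp x₀ L x ∈ Metric.closedBall x₀ L := by
  rw [Metric.mem_closedBall, dist_pi_le_iff hL]
  intro i
  rw [Real.dist_eq, abs_le, piClamp]
  constructor
  · linarith [le_max_left (x₀ i - L) (min (x₀ i + L) (x i))]
  · have : max (x₀ i - L) (min (x₀ i + L) (x i)) ≤ x₀ i + L :=
      max_le (by linarith) (min_le_left _ _)
    linarith

theorem piClamp_of_mem_closedBall (hL : 0 ≤ L) {x : ι → ℝ} (hx : x ∈ Metric.closedBall x₀ L) :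
    piClamp x₀ L x = x := by
  rw [Metric.mem_closedBall, dist_pi_le_iff hL] at hx
  funext i
  have h := abs_le.1 ((Real.dist_eq _ _).symm.trans_le (hx i))
  rw [piClamp, min_eq_right (by linarith), max_eq_right (by linarith)]

end piClamp

/-- If every integral curve from `x₀` of a `C¹` vector field on `ℝⁿ` stays at distance less than
`L` from `x₀` as long as it exists, then there is an integral curve from `x₀` for all nonnegative
times. -/
theorem ContDiff.exists_forall_hasDerivWithinAt_Ici {ι : Type*} [Fintype ι]
    {X : (ι → ℝ) → ι → ℝ} (hX : ContDiff ℝ 1 X) {x₀ : ι → ℝ} {L : ℝ} (hL : 0 < L)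
    (hbound : ∀ (T : ℝ) (u : ℝ → ι → ℝ), 0 ≤ T → u 0 = x₀ →
      (∀ t ∈ Icc 0 T, HasDerivWithinAt u (X (u t)) (Icc 0 T) t) → ‖u T - x₀‖ < L) :
    ∃ u : ℝ → ι → ℝ, u 0 = x₀ ∧ ∀ t ∈ Ici (0 : ℝ), HasDerivWithinAt u (X (u t)) (Ici 0) t := by
  have hcomp : IsCompact (Metric.closedBall x₀ L) := isCompact_closedBall x₀ L
  obtain ⟨K, hK⟩ := LocallyLipschitzOn.exists_lipschitzOnWith_of_compact hcomp
    hX.locallyLipschitz.locallyLipschitzOn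
  obtain ⟨N, hN⟩ := hcomp.exists_bound_of_continuousOn hX.continuous.continuousOn
  have hmem := piClamp_mem_closedBall x₀ hL.le
  have hlip : LipschitzWith K fun x => X (piClamp x₀ L x) :=
    LipschitzWith.of_dist_le_mul fun x y =>
      (hK.dist_le_mul _ (hmem x) _ (hmem y)).trans <| by
        have := (lipschitzWith_piClamp x₀ (L := L)).dist_le_mul x y
        rw [NNReal.coe_one, one_mul] at this
        gcongr
  obtain ⟨u, hu0, hu⟩ := hlip.exists_forall_hasDerivWithinAt_Ici (L := N.toNNReal)
    (fun x => (hN _ (hmem x)).trans (Real.le_coe_toNNReal N)) x₀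
  have huc : ContinuousOn u (Ici 0) := fun t ht => (hu t ht).continuousWithinAt
  have hin : ∀ t, 0 ≤ t → ‖u t - x₀‖ < L := by
    -- At the first exit time `τ` the truncation has not yet acted, so `u` solves the original
    -- equation on `[0, τ]` and `hbound` applies at `τ`.
    by_contra! hcon
    obtain ⟨t₁, ht₁, hLt₁⟩ := hcon
    have hclosed : IsClosed {t ∈ Ici (0 : ℝ) | L ≤ ‖u t - x₀‖} :=
      isClosed_Ici.isClosed_le continuousOn_const (huc.sub continuousOn_const).norm
    have hbdd : BddBelow {t ∈ Ici (0 : ℝ) | L ≤ ‖u t - x₀‖} := ⟨0, fun t ht => ht.1⟩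
    have hτ := hclosed.csInf_mem ⟨t₁, ht₁, hLt₁⟩ hbdd
    set τ := sInf {t ∈ Ici (0 : ℝ) | L ≤ ‖u t - x₀‖} with hτdef
    have hlt : ∀ t ∈ Ico 0 τ, ‖u t - x₀‖ < L := fun t ht => by
      by_contra! h
      exact absurd (csInf_le hbdd ⟨ht.1, h⟩) (not_le.2 ht.2)
    have hτ0 : 0 < τ := by
      refine lt_of_le_of_ne hτ.1 fun h => ?_
      have := hτ.2
      rw [← h, hu0, sub_self, norm_zero] at this
      linarith
    have hle : ∀ t ∈ Icc 0 τ, u t ∈ Metric.closedBall x₀ L := by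
      have hsub : Ico 0 τ ⊆ {t ∈ Icc 0 τ | ‖u t - x₀‖ ≤ L} := fun t ht =>
        ⟨Ico_subset_Icc_self ht, (hlt t ht).le⟩
      have hcl : IsClosed {t ∈ Icc 0 τ | ‖u t - x₀‖ ≤ L} := isClosed_Icc.isClosed_le
        ((huc.mono Icc_subset_Ici_self).sub continuousOn_const).norm continuousOn_const
      intro t ht
      have := closure_minimal hsub hcl (closure_Ico hτ0.ne ▸ ht)
      rw [mem_closedBall_iff_norm]
      exact this.2
    refine absurd (hbound τ u hτ0.le hu0 fun t ht => ?_) (not_lt.2 hτ.2)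
    have := (hu t ht.1).mono (fun s (hs : s ∈ Icc 0 τ) => hs.1)
    rwa [piClamp_of_mem_closedBall x₀ hL.le (hle t ht)] at this
  refine ⟨u, hu0, fun t ht => ?_⟩
  have := hu t ht
  rwa [piClamp_of_mem_closedBall x₀ hL.le (mem_closedBall_iff_norm.2 (hin t ht).le)] at this

/-! ### The abstract normalized Ricci flow and its maximum principle. -/

/-- The properties of the curvature map of circle packings, in the logarithmic coordinates
`u = log r`, that drive the normalized combinatorial Ricci flow. -/
structure IsCurvatureMap {V : Type*} [Fintype V] (K : (V → ℝ) → V → ℝ) (κ : ℝ) : Prop where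
  contDiff : ContDiff ℝ 1 K
  le_of_le : ∀ {u v : V → ℝ} (i : V), u ≤ v → u i = v i → K v i ≤ K u i
  add_const : ∀ (u : V → ℝ) (c : ℝ), K (fun j => u j + c) = K u
  sum_eq : ∀ u : V → ℝ, ∑ i, K u i = κ

/-- The curvature per unit of area, with area `exp (2 u i)` at `i`. -/
noncomputable def curvDensity {V : Type*} (K : (V → ℝ) → V → ℝ) (u : V → ℝ) (i : V) : ℝ :=
  K u i * Real.exp (-(2 * u i))

/-- The average curvature per unit of area. -/
noncomputable def avgDensity {V : Type*} [Fintype V] (κ : ℝ) (u : V → ℝ) : ℝ :=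
  κ / ∑ j, Real.exp (2 * u j)

/-- The vector field of the normalized Ricci flow in logarithmic coordinates. -/
noncomputable def logRicciField {V : Type*} [Fintype V] (K : (V → ℝ) → V → ℝ) (κ : ℝ)
    (u : V → ℝ) (i : V) : ℝ :=
  (avgDensity κ u - curvDensity K u i) / 2

theorem sum_exp_pos {V : Type*} [Fintype V] [Nonempty V] (u : V → ℝ) :
    0 < ∑ j, Real.exp (2 * u j) :=
  Finset.sum_pos (fun _ _ => Real.exp_pos _) Finset.univ_nonempty

namespace IsCurvatureMap

variable {V : Type*} [Fintype V] {K : (V → ℝ) → V → ℝ} {κ : ℝ}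

/-- The curvature at `i` does not increase in a direction that is smallest at `i`. -/
theorem fderiv_apply_nonpos (hK : IsCurvatureMap K κ) (u v : V → ℝ) (i : V)
    (hv : ∀ j, v i ≤ v j) : fderiv ℝ K u v i ≤ 0 := by
  have hline : HasDerivAt (fun s : ℝ => u + s • v) v 0 := by
    simpa using ((hasDerivAt_id (0 : ℝ)).smul_const v).const_add u
  have hd : HasFDerivAt K (fderiv ℝ K u) (u + (0 : ℝ) • v) := by
    simpa using (hK.contDiff.differentiable one_ne_zero u).hasFDerivAt
  have h := hasDerivAt_pi.1 (hd.comp_hasDerivAt (0 : ℝ) hline) i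
  refine le_of_tendsto h.tendsto_slope_zero_right ?_
  filter_upwards [self_mem_nhdsWithin] with s hs
  have hs' : (0 : ℝ) < s := hs
  have hle : K (u + s • v) i ≤ K u i := by
    -- Rescaling restores the `i`-th coordinate, and then no other coordinate has decreased.
    rw [← hK.add_const (u + s • v) (-(s * v i))]
    refine hK.le_of_le i (fun j => ?_) (by simp)
    have := mul_le_mul_of_nonneg_left (hv j) hs'.le
    simp only [Pi.add_apply, Pi.smul_apply, smul_eq_mul]
    linarith
  simp only [zero_add, Function.comp_apply, zero_smul, add_zero, smul_eq_mul]
  exact mul_nonpos_of_nonneg_of_nonpos (inv_nonneg.2 hs'.le) (sub_nonpos.2 hle)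

theorem fderiv_apply_nonneg (hK : IsCurvatureMap K κ) (u v : V → ℝ) (i : V)
    (hv : ∀ j, v j ≤ v i) : 0 ≤ fderiv ℝ K u v i := by
  have := hK.fderiv_apply_nonpos u (-v) i fun j => neg_le_neg (hv j)
  simpa using this

theorem sum_curvDensity (hK : IsCurvatureMap K κ) (u : V → ℝ) :
    ∑ i, curvDensity K u i * Real.exp (2 * u i) = κ := by
  rw [← hK.sum_eq u]
  refine Finset.sum_congr rfl fun i _ => ?_
  rw [curvDensity, mul_assoc, ← Real.exp_add, neg_add_cancel, Real.exp_zero, mul_one]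

/-- The evolution equation of the curvature under the flow. -/
theorem hasDerivWithinAt_curvDensity (hK : IsCurvatureMap K κ) {S : Set ℝ} {u : ℝ → V → ℝ} {t : ℝ}
    (hu : HasDerivWithinAt u (logRicciField K κ (u t)) S t) (i : V) :
    HasDerivWithinAt (fun s => curvDensity K (u s) i)
      (fderiv ℝ K (u t) (logRicciField K κ (u t)) i * Real.exp (-(2 * u t i)) +
        curvDensity K (u t) i * (curvDensity K (u t) i - avgDensity κ (u t))) S t := by
  have h1 := hasDerivWithinAt_pi.1
    ((hK.contDiff.differentiable one_ne_zero (u t)).hasFDerivAt.comp_hasDerivWithinAt t hu) i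
  have h2 := ((hasDerivWithinAt_pi.1 hu i).const_mul 2).neg.exp
  refine (h1.mul h2).congr_deriv ?_
  simp only [Function.comp_apply, logRicciField, curvDensity, Pi.neg_apply]
  ring

variable [Nonempty V]

theorem contDiff_logRicciField (hK : IsCurvatureMap K κ) : ContDiff ℝ 1 (logRicciField K κ) := by
  have hKi := contDiff_pi.1 hK.contDiff
  rw [contDiff_pi]
  intro i
  unfold logRicciField avgDensity curvDensity
  refine ContDiff.div_const (ContDiff.sub (ContDiff.div contDiff_const ?_
    fun u => (sum_exp_pos u).ne') ((hKi i).mul ?_)) _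
  · fun_prop
  · fun_prop

/-- The average is the mean of the curvatures with weights `exp (2 u i)`. It thereby inherits
negativity from them. -/
theorem avgDensity_le (hK : IsCurvatureMap K κ) {u : V → ℝ} {b : ℝ}
    (h : ∀ i, curvDensity K u i ≤ b) : avgDensity κ u ≤ b := by
  rw [avgDensity, div_le_iff₀ (sum_exp_pos u), ← hK.sum_curvDensity u, Finset.mul_sum]
  gcongr with i
  exact h i

/-- The total area is constant along the flow, hence so is the average curvature. -/
theorem avgDensity_eq (hK : IsCurvatureMap K κ) {T : ℝ} {u : ℝ → V → ℝ}
    (hu : ∀ t ∈ Icc 0 T, HasDerivWithinAt u (logRicciField K κ (u t)) (Icc 0 T) t)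
    {t : ℝ} (ht : t ∈ Icc 0 T) : avgDensity κ (u t) = avgDensity κ (u 0) := by
  have hd : ∀ t ∈ Icc 0 T,
      HasDerivWithinAt (fun t => ∑ j, Real.exp (2 * u t j)) 0 (Icc 0 T) t := by
    intro t ht
    have := HasDerivWithinAt.fun_sum (u := Finset.univ) fun j _ =>
      ((hasDerivWithinAt_pi.1 (hu t ht) j).const_mul 2).exp
    refine this.congr_deriv ?_
    have h1 : ∀ j, Real.exp (2 * u t j) * (2 * logRicciField K κ (u t) j) =
        avgDensity κ (u t) * Real.exp (2 * u t j) -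
          curvDensity K (u t) j * Real.exp (2 * u t j) := fun j => by
      rw [logRicciField]; ring
    rw [Finset.sum_congr rfl fun j _ => h1 j, Finset.sum_sub_distrib, hK.sum_curvDensity,
      ← Finset.mul_sum, avgDensity, div_mul_cancel₀ _ (sum_exp_pos _).ne', sub_self]
  have := (convex_Icc 0 T).norm_image_sub_le_of_norm_hasDerivWithin_le (C := 0) hd
    (fun _ _ => by simp) ⟨le_rfl, ht.1.trans ht.2⟩ ht
  rw [zero_mul, norm_le_zero_iff, sub_eq_zero] at this
  rw [avgDensity, avgDensity, this]

/-- **Maximum principle**: negative curvature converges exponentially fast to its average along the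
flow, with constants that depend only on the initial metric. -/
theorem exists_abs_avgDensity_sub_le (hK : IsCurvatureMap K κ) {u₀ : V → ℝ}
    (hneg : ∀ i, curvDensity K u₀ i < 0) :
    ∃ A > 0, ∃ a > 0, ∀ (T : ℝ) (u : ℝ → V → ℝ), u 0 = u₀ →
      (∀ t ∈ Icc 0 T, HasDerivWithinAt u (logRicciField K κ (u t)) (Icc 0 T) t) →
      ∀ t ∈ Icc 0 T, ∀ i, |avgDensity κ (u t) - curvDensity K (u t) i| ≤
        A * Real.exp (-a * t) := by
  obtain ⟨i₁, hi₁⟩ := Finite.exists_max (curvDensity K u₀)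
  obtain ⟨i₂, hi₂⟩ := Finite.exists_min (curvDensity K u₀)
  set α := curvDensity K u₀ i₁ with hα
  set β := curvDensity K u₀ i₂ with hβ
  set c := avgDensity κ u₀ with hc
  have hα0 : α < 0 := hneg i₁
  have hcα : c ≤ α := hK.avgDensity_le hi₁
  -- The upper barrier starts at `α / 2`, not `α`, so that `A₁ > 0` even if the initial curvature is
  -- constant. Below `α / 2` the reaction term decays at rate at least `-α / 2`, twice the `a`
  -- chosen here, which makes the comparison strict. The `+ 1` in `A₂` only ensures positivity.
  set A₁ := α / 2 - c with hA₁
  set A₂ := |c - β| + 1 with hA₂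
  set a := -α / 4 with ha
  have hA₁0 : 0 < A₁ := by linarith
  have hA₂0 : 0 < A₂ := by positivity
  have ha0 : 0 < a := by linarith
  have hexp : ∀ A t, HasDerivAt (fun t => A * Real.exp (-a * t))
      (-(a * (A * Real.exp (-a * t)))) t := by
    intro A t
    have h1 : HasDerivAt (fun x => Real.exp (-a * x)) (Real.exp (-a * t) * (-a * 1)) t :=
      ((hasDerivAt_id t).const_mul (-a)).exp
    exact (h1.const_mul A).congr_deriv (by ring)
  refine ⟨max A₁ A₂, lt_max_of_lt_left hA₁0, a, ha0, fun T u hu0 hu => ?_⟩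
  have havg : ∀ t ∈ Icc 0 T, avgDensity κ (u t) = c := fun t ht => by
    rw [hK.avgDensity_eq hu ht, hu0]
  have hd := fun (i : V) (t : ℝ) (ht : t ∈ Icc 0 T) => hK.hasDerivWithinAt_curvDensity (hu t ht) i
  have hE1 : ∀ t ∈ Icc 0 T, Real.exp (-a * t) ≤ 1 := fun t ht => by
    rw [Real.exp_le_one_iff, neg_mul, neg_nonpos]
    exact mul_nonneg ha0.le ht.1
  have hupper : ∀ t ∈ Icc 0 T, ∀ i, curvDensity K (u t) i ≤ c + A₁ * Real.exp (-a * t) := by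
    refine forall_le_of_deriv_lt_of_touching hd (fun t => (hexp A₁ t).const_add c) ?_ ?_
    · intro i
      rw [hu0, mul_zero, Real.exp_zero, mul_one]
      linarith [hi₁ i]
    · intro t ht i heq hle
      have hP := mul_pos hA₁0 (Real.exp_pos (-a * t))
      have hB : c + A₁ * Real.exp (-a * t) ≤ α / 2 := by
        have := mul_le_mul_of_nonneg_left (hE1 t ht) hA₁0.le
        linarith
      have h1 : fderiv ℝ K (u t) (logRicciField K κ (u t)) i * Real.exp (-(2 * u t i)) ≤ 0 := by
        refine mul_nonpos_of_nonpos_of_nonneg (hK.fderiv_apply_nonpos _ _ _ fun j => ?_)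
          (Real.exp_pos _).le
        simp only [logRicciField]
        linarith [hle j]
      -- With `P = A₁ e^{-at}`, the reaction term is `(c + P) P ≤ (α / 2) P < (α / 4) P = -a P`.
      rw [havg t ht, heq]
      nlinarith
  have hlower : ∀ t ∈ Icc 0 T, ∀ i, -curvDensity K (u t) i ≤ -c + A₂ * Real.exp (-a * t) := by
    refine forall_le_of_deriv_lt_of_touching (fun i t ht => (hd i t ht).neg)
      (fun t => (hexp A₂ t).const_add (-c)) ?_ ?_
    · intro i
      simp only [hu0, mul_zero, Real.exp_zero, mul_one]
      linarith [hi₂ i, le_abs_self (c - β)]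
    · intro t ht i heq hle
      change -curvDensity K (u t) i = _ at heq
      change ∀ j, -curvDensity K (u t) j ≤ _ at hle
      have hP := mul_pos hA₂0 (Real.exp_pos (-a * t))
      have h1 : 0 ≤ fderiv ℝ K (u t) (logRicciField K κ (u t)) i * Real.exp (-(2 * u t i)) := by
        refine mul_nonneg (hK.fderiv_apply_nonneg _ _ _ fun j => ?_) (Real.exp_pos _).le
        simp only [logRicciField]
        linarith [hle j]
      have heq' : curvDensity K (u t) i = c - A₂ * Real.exp (-a * t) := by linarith
      -- With `P = A₂ e^{-at}`, the reaction term of `-R_i` is `(c - P) P < -a P`, because `c ≤ α <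
      -- α / 4`.
      rw [havg t ht, heq']
      nlinarith
  intro t ht i
  rw [havg t ht, abs_le]
  have hE := (Real.exp_pos (-a * t)).le
  have h1 := mul_le_mul_of_nonneg_right (le_max_left A₁ A₂) hE
  have h2 := mul_le_mul_of_nonneg_right (le_max_right A₁ A₂) hE
  constructor
  · linarith [hupper t ht i]
  · linarith [hlower t ht i]

/-- Starting from negative curvature, the normalized Ricci flow exists for all nonnegative times and
converges exponentially fast to a point of constant negative curvature. -/
theorem exists_flow (hK : IsCurvatureMap K κ) {u₀ : V → ℝ}
    (hneg : ∀ i, curvDensity K u₀ i < 0) :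
    ∃ x : V → ℝ, (∃ c < 0, ∀ i, curvDensity K x i = c) ∧ ∃ u : ℝ → V → ℝ, u 0 = u₀ ∧
      (∀ t ∈ Ici (0 : ℝ), HasDerivWithinAt u (logRicciField K κ (u t)) (Ici 0) t) ∧
      ∃ C > 0, ∃ a > 0, ∀ t ≥ (0 : ℝ), ‖u t - x‖ ≤ C * Real.exp (-a * t) := by
  obtain ⟨A, hA, a, ha, hest⟩ := hK.exists_abs_avgDensity_sub_le hneg
  have hnorm : ∀ (T : ℝ) (u : ℝ → V → ℝ), u 0 = u₀ →
      (∀ t ∈ Icc 0 T, HasDerivWithinAt u (logRicciField K κ (u t)) (Icc 0 T) t) →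
      ∀ t ∈ Icc 0 T, ‖logRicciField K κ (u t)‖ ≤ A * Real.exp (-a * t) := by
    intro T u hu0 hu t ht
    rw [pi_norm_le_iff_of_nonneg (by positivity)]
    intro i
    rw [logRicciField, Real.norm_eq_abs, abs_div, abs_two]
    linarith [hest T u hu0 hu t ht i, abs_nonneg (avgDensity κ (u t) - curvDensity K (u t) i)]
  have hsub : ∀ (T : ℝ) (u : ℝ → V → ℝ), u 0 = u₀ →
      (∀ t ∈ Icc 0 T, HasDerivWithinAt u (logRicciField K κ (u t)) (Icc 0 T) t) →
      ∀ s, 0 ≤ s → s ≤ T → ‖u T - u s‖ ≤ A / a * Real.exp (-a * s) := by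
    intro T u hu0 hu s hs hsT
    have hss : Icc s T ⊆ Icc 0 T := Icc_subset_Icc_left hs
    have h := norm_sub_le_of_norm_deriv_le_exp ha hsT
      (fun x hx => (hu x (hss hx)).mono hss) (fun x hx => hnorm T u hu0 hu x (hss hx))
    have h2 : 0 ≤ A / a * Real.exp (-a * T) := by positivity
    rw [mul_sub] at h
    linarith
  -- The total displacement is at most `A / a`; the extra `1` gives the strict bound required.
  obtain ⟨u, hu0, hu⟩ := hK.contDiff_logRicciField.exists_forall_hasDerivWithinAt_Ici
    (x₀ := u₀) (L := A / a + 1) (by positivity) fun T u hT hu0 hu => by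
      have := hsub T u hu0 hu 0 le_rfl hT
      rw [hu0, mul_zero, Real.exp_zero, mul_one] at this
      linarith
  have huT : ∀ T : ℝ, ∀ t ∈ Icc 0 T,
      HasDerivWithinAt u (logRicciField K κ (u t)) (Icc 0 T) t :=
    fun T t ht => (hu t ht.1).mono Icc_subset_Ici_self
  obtain ⟨x, hx⟩ := exists_forall_norm_sub_le_exp (C := A / a) ha
    fun s t hs hst => hsub t u hu0 (huT t) s hs hst
  refine ⟨x, ⟨avgDensity κ u₀, ?_, fun i => ?_⟩, u, hu0, hu, A / a, by positivity, a, ha, hx⟩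
  · obtain ⟨i₁, hi₁⟩ := Finite.exists_max (curvDensity K u₀)
    exact (hK.avgDensity_le hi₁).trans_lt (hneg i₁)
  · have hE : Tendsto (fun t : ℝ => Real.exp (-a * t)) atTop (𝓝 0) := by
      have h : Tendsto (fun t : ℝ => a * t) atTop atTop := tendsto_id.const_mul_atTop ha
      simpa [Function.comp_def] using Real.tendsto_exp_neg_atTop_nhds_zero.comp h
    have hux : Tendsto u atTop (𝓝 x) := by
      rw [tendsto_iff_norm_sub_tendsto_zero]
      refine squeeze_zero' (Eventually.of_forall fun _ => norm_nonneg _) ?_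
        ((hE.const_mul (A / a)).trans (by rw [mul_zero]))
      filter_upwards [eventually_ge_atTop 0] with t ht using hx t ht
    have hcont : Continuous fun v => curvDensity K v i := by
      have := (contDiff_pi.1 hK.contDiff i).continuous
      unfold curvDensity
      fun_prop
    have h1 : Tendsto (fun t => |avgDensity κ u₀ - curvDensity K (u t) i|) atTop
        (𝓝 |avgDensity κ u₀ - curvDensity K x i|) :=
      (((hcont.tendsto x).comp hux).const_sub _).abs
    have h2 : Tendsto (fun t => |avgDensity κ u₀ - curvDensity K (u t) i|) atTop (𝓝 0) := by
      refine squeeze_zero' (Eventually.of_forall fun _ => abs_nonneg _) ?_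
        ((hE.const_mul A).trans (by rw [mul_zero]))
      filter_upwards [eventually_ge_atTop 0] with t ht
      have := hest t u hu0 (huT t) t ⟨ht, le_rfl⟩ i
      rwa [hK.avgDensity_eq (huT t) ⟨ht, le_rfl⟩, hu0] at this
    have := tendsto_nhds_unique h1 h2
    rw [abs_eq_zero, sub_eq_zero] at this
    exact this.symm

end IsCurvatureMap

/-! ### Euclidean triangles and the law of cosines. -/

/-- The cosine of the angle between the sides of lengths `a`, `b` of a Euclidean triangle whose
third side has length `c`. -/
noncomputable def lawOfCosines (a b c : ℝ) : ℝ :=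
  (a ^ 2 + b ^ 2 - c ^ 2) / (2 * a * b)

section lawOfCosines

variable {a b c : ℝ}

theorem lawOfCosines_comm (a b c : ℝ) : lawOfCosines a b c = lawOfCosines b a c := by
  rw [lawOfCosines, lawOfCosines]
  congr 1 <;> ring

/-- `2ab (1 - cos) = c² - (a - b)² = (b + c - a)(a + c - b)`. Strictness keeps the cosine away from
the endpoints, where `arccos` is not differentiable. -/
theorem lawOfCosines_lt_one (ha : 0 < a) (hb : 0 < b) (h₁ : a < b + c) (h₂ : b < a + c) :
    lawOfCosines a b c < 1 := by
  rw [lawOfCosines, div_lt_one (by positivity)]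
  nlinarith [mul_pos (sub_pos.2 h₁) (sub_pos.2 h₂)]

theorem neg_one_lt_lawOfCosines (ha : 0 < a) (hb : 0 < b) (hc : 0 < c) (h : c < a + b) :
    -1 < lawOfCosines a b c := by
  rw [lawOfCosines, lt_div_iff₀ (by positivity)]
  nlinarith [mul_pos (sub_pos.2 h) (add_pos (add_pos ha hb) hc)]

theorem angle_eq_arccos_lawOfCosines {E : Type*} [NormedAddCommGroup E] [InnerProductSpace ℝ E]
    (x y : E) :
    InnerProductGeometry.angle x y = Real.arccos (lawOfCosines ‖x‖ ‖y‖ ‖x - y‖) := by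
  rw [InnerProductGeometry.angle, lawOfCosines,
    real_inner_eq_norm_mul_self_add_norm_mul_self_sub_norm_sub_mul_self_div_two, div_div]
  congr 2 <;> ring

/-- Take `a` and `b e^{iα}`, with `α` given by the law of cosines. This transfers the angle sum of
vectors to side lengths. -/
theorem exists_norm_eq_of_triangle (ha : 0 < a) (hb : 0 < b) (hc : 0 < c)
    (h₁ : a < b + c) (h₂ : b < a + c) (h₃ : c < a + b) :
    ∃ x y : ℂ, ‖x‖ = a ∧ ‖y‖ = b ∧ ‖x - y‖ = c := by
  set α := Real.arccos (lawOfCosines a b c) with hα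
  have hcos : Real.cos α = lawOfCosines a b c :=
    Real.cos_arccos (neg_one_lt_lawOfCosines ha hb hc h₃).le (lawOfCosines_lt_one ha hb h₁ h₂).le
  refine ⟨a, ⟨b * Real.cos α, b * Real.sin α⟩, ?_, ?_, ?_⟩
  · rw [Complex.norm_real, Real.norm_of_nonneg ha.le]
  · rw [← sq_eq_sq₀ (norm_nonneg _) hb.le, Complex.sq_norm, Complex.normSq_apply]
    linear_combination b ^ 2 * Real.sin_sq_add_cos_sq α
  · rw [← sq_eq_sq₀ (norm_nonneg _) hc.le, Complex.sq_norm, Complex.normSq_apply]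
    simp only [Complex.sub_re, Complex.sub_im, Complex.ofReal_re, Complex.ofReal_im]
    have h : 2 * a * b * Real.cos α = a ^ 2 + b ^ 2 - c ^ 2 := by
      rw [hcos, lawOfCosines]
      field_simp
    linear_combination b ^ 2 * Real.sin_sq_add_cos_sq α - h

/-- The angles of a Euclidean triangle add up to `π`. -/
theorem arccos_lawOfCosines_add_add (ha : 0 < a) (hb : 0 < b) (hc : 0 < c)
    (h₁ : a < b + c) (h₂ : b < a + c) (h₃ : c < a + b) :
    Real.arccos (lawOfCosines a b c) + Real.arccos (lawOfCosines c a b) +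
      Real.arccos (lawOfCosines b c a) = Real.pi := by
  obtain ⟨x, y, rfl, rfl, rfl⟩ := exists_norm_eq_of_triangle ha hb hc h₁ h₂ h₃
  have hy : y ≠ 0 := norm_pos_iff.1 hb
  have h := InnerProductGeometry.angle_add_angle_sub_add_angle_sub_eq_pi x hy
  rw [angle_eq_arccos_lawOfCosines, angle_eq_arccos_lawOfCosines, angle_eq_arccos_lawOfCosines,
    sub_sub_cancel, sub_sub_cancel, norm_sub_rev y x] at h
  rwa [lawOfCosines_comm ‖x - y‖ ‖x‖]

end lawOfCosines

/-! ### Three circles: triangle inequality and monotonicity of angles. -/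

/-- The distance of the centres of two circles of radii `x`, `y` that meet at an angle of
cosine `C`. -/
noncomputable def circleDist (x y C : ℝ) : ℝ :=
  Real.sqrt (x ^ 2 + y ^ 2 + 2 * x * y * C)

section circleDist

variable {x y z A B C : ℝ}

theorem circleDist_comm (x y C : ℝ) : circleDist x y C = circleDist y x C := by
  rw [circleDist, circleDist]
  congr 1
  ring

theorem circleDist_arg_pos (hx : 0 < x) (hy : 0 < y) (hC : 0 ≤ C) :
    0 < x ^ 2 + y ^ 2 + 2 * x * y * C := by
  positivity

theorem circleDist_pos (hx : 0 < x) (hy : 0 < y) (hC : 0 ≤ C) : 0 < circleDist x y C :=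
  Real.sqrt_pos.2 (circleDist_arg_pos hx hy hC)

theorem sq_circleDist (hx : 0 < x) (hy : 0 < y) (hC : 0 ≤ C) :
    circleDist x y C ^ 2 = x ^ 2 + y ^ 2 + 2 * x * y * C :=
  Real.sq_sqrt (circleDist_arg_pos hx hy hC).le

theorem circleDist_le (hx : 0 < x) (hy : 0 < y) (hC : C ≤ 1) : circleDist x y C ≤ x + y := by
  rw [circleDist, Real.sqrt_le_left (by positivity)]
  nlinarith [mul_pos hx hy]

theorem lt_circleDist (hx : 0 < x) (hy : 0 < y) (hC : 0 ≤ C) : x < circleDist x y C := by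
  rw [circleDist, Real.lt_sqrt hx.le]
  have := mul_nonneg (mul_pos hx hy).le hC
  nlinarith [pow_pos hy 2]

theorem circleDist_mul {s : ℝ} (hs : 0 ≤ s) (x y C : ℝ) :
    circleDist (s * x) (s * y) C = s * circleDist x y C := by
  rw [circleDist, circleDist, ← Real.sqrt_sq hs, ← Real.sqrt_mul (sq_nonneg s), Real.sqrt_sq hs]
  congr 1
  ring

/-- The three distances between the centres of three circles that meet at non-obtuse angles satisfy
the strict triangle inequality. -/
theorem circleDist_lt_add (hx : 0 < x) (hy : 0 < y) (hz : 0 < z) (hA : 0 ≤ A) (hB : 0 ≤ B)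
    (hC : C ≤ 1) : circleDist x y C < circleDist x z B + circleDist y z A := by
  linarith [circleDist_le hx hy hC, lt_circleDist hx hz hB, lt_circleDist hy hz hA]

/-- The angle at the centre of the circle of radius `x` grows with the radius `y` of another
circle: its cosine decreases. -/
theorem antitoneOn_lawOfCosines_circleDist (hx : 0 < x) (hz : 0 < z) (hA : 0 ≤ A) (hB : 0 ≤ B)
    (hC : 0 ≤ C) (hC1 : C ≤ 1) :
    AntitoneOn (fun y => lawOfCosines (circleDist x y C) (circleDist x z B) (circleDist y z A))
      (Ioi 0) := by
  set p := x ^ 2 + x * z * B with hp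
  set q := x * C - z * A with hq
  have hl := circleDist_pos hx hz hB
  have heq : ∀ y ∈ Ioi (0 : ℝ),
      lawOfCosines (circleDist x y C) (circleDist x z B) (circleDist y z A) =
        (p + q * y) / circleDist x y C / circleDist x z B := by
    intro y hy
    have h1 := circleDist_pos hx hy hC
    rw [lawOfCosines, sq_circleDist hx hy hC, sq_circleDist hx hz hB, sq_circleDist hy hz hA,
      div_div, div_eq_div_iff (by positivity) (by positivity), hp, hq]
    ring
  have hder : ∀ y ∈ Ioi (0 : ℝ), HasDerivAt (fun y => (p + q * y) / circleDist x y C)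
      ((q * circleDist x y C - (p + q * y) * ((2 * y + 2 * x * C) / (2 * circleDist x y C))) /
        circleDist x y C ^ 2) y := by
    intro y hy
    have hQ : HasDerivAt (fun y => x ^ 2 + y ^ 2 + 2 * x * y * C) (2 * y + 2 * x * C) y := by
      have h1 := ((hasDerivAt_pow 2 y).const_add (x ^ 2)).add
        (((hasDerivAt_id y).const_mul (2 * x)).mul_const C)
      exact h1.congr_deriv (by norm_num)
    have hs := hQ.sqrt (circleDist_arg_pos hx hy hC).ne'
    have hn : HasDerivAt (fun y => p + q * y) q y :=
      (((hasDerivAt_id y).const_mul q).const_add p).congr_deriv (by simp)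
    exact hn.div hs (circleDist_pos hx hy hC).ne'
  have hanti : AntitoneOn (fun y => (p + q * y) / circleDist x y C) (Ioi 0) := by
    refine antitoneOn_of_deriv_nonpos (convex_Ioi 0)
      (fun y hy => (hder y hy).continuousAt.continuousWithinAt) ?_ ?_ <;> rw [interior_Ioi]
    · exact fun y hy => (hder y hy).differentiableAt.differentiableWithinAt
    · intro y hy
      have hy0 : 0 < y := hy
      have hd := circleDist_pos hx hy0 hC
      rw [(hder y hy).deriv]
      refine div_nonpos_of_nonpos_of_nonneg ?_ (sq_nonneg _)
      have h2 : q * circleDist x y C -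
          (p + q * y) * ((2 * y + 2 * x * C) / (2 * circleDist x y C)) =
          (q * circleDist x y C ^ 2 - (p + q * y) * (y + x * C)) / circleDist x y C := by
        field_simp
      rw [h2, sq_circleDist hx hy0 hC]
      refine div_nonpos_of_nonpos_of_nonneg ?_ hd.le
      -- The numerator of the derivative is minus a sum of products of nonnegative terms; this is
      -- where non-obtuse intersection angles are needed.
      have h3 : q * (x ^ 2 + y ^ 2 + 2 * x * y * C) - (p + q * y) * (y + x * C) =
          -(x * (x * y * ((1 - C) * (1 + C)) +
            z * (A * x + A * C * y + B * y + B * C * x))) := by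
        rw [hp, hq]
        ring
      rw [h3, neg_nonpos]
      have h4 : 0 ≤ 1 - C := sub_nonneg.2 hC1
      positivity
  intro y hy y' hy' hyy
  simp only [heq y hy, heq y' hy']
  exact div_le_div_of_nonneg_right (hanti hy hy' hyy) hl.le

/-- The angle at the centre of the circle of radius `x` grows with the radii of the other two
circles. -/
theorem lawOfCosines_circleDist_anti {y' z' : ℝ} (hx : 0 < x) (hy : 0 < y) (hz : 0 < z)
    (hA : 0 ≤ A) (hB : 0 ≤ B) (hB1 : B ≤ 1) (hC : 0 ≤ C) (hC1 : C ≤ 1) (hyy : y ≤ y')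
    (hzz : z ≤ z') :
    lawOfCosines (circleDist x y' C) (circleDist x z' B) (circleDist y' z' A) ≤
      lawOfCosines (circleDist x y C) (circleDist x z B) (circleDist y z A) := by
  have hy' : 0 < y' := hy.trans_le hyy
  have hz' : 0 < z' := hz.trans_le hzz
  refine le_trans ?_ (antitoneOn_lawOfCosines_circleDist hx hz hA hB hC hC1 hy hy' hyy)
  have := antitoneOn_lawOfCosines_circleDist hx hy' hA hC hB hB1 hz hz' hzz
  simp only at this
  rwa [lawOfCosines_comm, circleDist_comm z', lawOfCosines_comm (circleDist x z B),
    circleDist_comm z] at this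

end circleDist

/-! ### Counting edges and triangles. -/

open scoped Classical in
theorem Finset.card_filter_insert_pair_eq {V : Type*} [Fintype V] {s : Finset V}
    (hs : s.card = 3) :
    (Finset.univ.filter fun p : V × V × V => ({p.1, p.2.1, p.2.2} : Finset V) = s).card = 6 := by
  obtain ⟨a, b, c, hab, hac, hbc, rfl⟩ := Finset.card_eq_three.1 hs
  have : (Finset.univ.filter fun p : V × V × V => ({p.1, p.2.1, p.2.2} : Finset V) = {a, b, c}) =
      {(a, b, c), (a, c, b), (b, a, c), (b, c, a), (c, a, b), (c, b, a)} := by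
    ext ⟨i, j, k⟩
    simp only [Finset.mem_filter, Finset.mem_univ, true_and, Finset.mem_insert,
      Finset.mem_singleton, Prod.mk.injEq]
    constructor
    · intro h
      have hi : i ∈ ({a, b, c} : Finset V) := h ▸ by simp
      have hj : j ∈ ({a, b, c} : Finset V) := h ▸ by simp
      have hk : k ∈ ({a, b, c} : Finset V) := h ▸ by simp
      have ha : a ∈ ({i, j, k} : Finset V) := h ▸ by simp
      have hb : b ∈ ({i, j, k} : Finset V) := h ▸ by simp
      have hc : c ∈ ({i, j, k} : Finset V) := h ▸ by simp
      simp only [Finset.mem_insert, Finset.mem_singleton] at hi hj hk ha hb hc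
      grind
    · rintro (⟨rfl, rfl, rfl⟩ | ⟨rfl, rfl, rfl⟩ | ⟨rfl, rfl, rfl⟩ | ⟨rfl, rfl, rfl⟩ |
        ⟨rfl, rfl, rfl⟩ | ⟨rfl, rfl, rfl⟩) <;> ext <;> simp <;> tauto
  rw [this]
  grind

namespace TriangulatedSurface

variable {V : Type*}

theorem mem_faces_of_subset (M : TriangulatedSurface V) {s t : Finset V} (hs : s ∈ M.faces)
    (hts : t ⊆ s) (ht : t.Nonempty) : t ∈ M.faces :=
  M.isRelLowerSet_faces.mem_of_le hs hts ht

variable [Fintype V]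

theorem mem_edges (M : TriangulatedSurface V) {s : Finset V} :
    s ∈ M.edges ↔ s ∈ M.faces ∧ s.card = 2 := by
  simp [edges]

theorem mem_triangles (M : TriangulatedSurface V) {s : Finset V} :
    s ∈ M.triangles ↔ s ∈ M.faces ∧ s.card = 3 := by
  simp [triangles]

/-- Every edge lies in two triangles and every triangle has three edges. -/
theorem two_mul_card_edges (M : TriangulatedSurface V) :
    M.edges.card * 2 = M.triangles.card * 3 := by
  classical
  have h := Finset.sum_card_bipartiteAbove_eq_sum_card_bipartiteBelow
    (fun e t : Finset V => e ⊆ t) (s := M.edges) (t := M.triangles)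
  have h1 : ∀ e ∈ M.edges,
      (Finset.bipartiteAbove (fun e t : Finset V => e ⊆ t) M.triangles e).card = 2 := by
    intro e he
    rw [mem_edges] at he
    rw [← M.edge_two_triangles e he.1 he.2, ← Set.ncard_coe_finset]
    congr 1
    ext t
    simp [Finset.bipartiteAbove, mem_triangles, and_assoc]
  have h2 : ∀ t ∈ M.triangles,
      (Finset.bipartiteBelow (fun e t : Finset V => e ⊆ t) M.edges t).card = 3 := by
    intro t ht
    rw [mem_triangles] at ht
    have : Finset.bipartiteBelow (fun e t : Finset V => e ⊆ t) M.edges t =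
        t.powersetCard 2 := by
      ext e
      simp only [Finset.bipartiteBelow, Finset.mem_filter, mem_edges, Finset.mem_powersetCard]
      refine ⟨fun h => ⟨h.2, h.1.2⟩, fun h => ⟨⟨M.mem_faces_of_subset ht.1 h.1 ?_, h.2⟩, h.1⟩⟩
      exact Finset.card_pos.1 (by omega)
    rw [this, Finset.card_powersetCard, ht.2]
    rfl
  rwa [Finset.sum_congr rfl h1, Finset.sum_congr rfl h2, Finset.sum_const, Finset.sum_const,
    smul_eq_mul, smul_eq_mul] at h

-- The curvature sums run over ordered triples, so each triangle occurs `3! = 6` times.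
open scoped Classical in
theorem sum_ite_mem_triangles (M : TriangulatedSurface V) (c : ℝ) :
    ∑ i : V, ∑ j : V, ∑ k : V, (if ({i, j, k} : Finset V) ∈ M.triangles then c else 0) =
      6 * M.triangles.card * c := by
  have h1 : ∀ i j k : V, (if ({i, j, k} : Finset V) ∈ M.triangles then c else 0) =
      ∑ s ∈ M.triangles, if ({i, j, k} : Finset V) = s then c else 0 := fun i j k => by
    rw [Finset.sum_ite_eq]
  have h2 : ∑ p : V × V × V, ∑ s ∈ M.triangles,
      (if ({p.1, p.2.1, p.2.2} : Finset V) = s then c else 0) = 6 * M.triangles.card * c := by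
    rw [Finset.sum_comm]
    have h3 : ∀ s ∈ M.triangles, ∑ p : V × V × V,
        (if ({p.1, p.2.1, p.2.2} : Finset V) = s then c else 0) = 6 * c := fun s hs => by
      rw [← Finset.sum_filter, Finset.sum_const,
        Finset.card_filter_insert_pair_eq (M.mem_triangles.1 hs).2, nsmul_eq_mul]
      norm_num
    rw [Finset.sum_congr rfl h3, Finset.sum_const, nsmul_eq_mul]
    ring
  simp only [h1]
  rw [← h2, Fintype.sum_prod_type]
  simp only [Fintype.sum_prod_type]

end TriangulatedSurface

/-! ### The angle deficit is a curvature map. -/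

namespace WeightedTriangulatedSurface

section

open scoped Classical

variable {V : Type*} (M : WeightedTriangulatedSurface V) {r : V → ℝ} {i j k : V}

theorem edgeLength_eq_circleDist (r : V → ℝ) (i j : V) :
    M.edgeLength r i j = circleDist (r i) (r j) (Real.cos (M.Φ {i, j})) := rfl

theorem edgeLength_comm (r : V → ℝ) (i j : V) : M.edgeLength r i j = M.edgeLength r j i := by
  rw [edgeLength_eq_circleDist, edgeLength_eq_circleDist, circleDist_comm, Finset.pair_comm]

theorem angle_eq_arccos (r : V → ℝ) (i j k : V) : M.angle r i j k =
    Real.arccos (lawOfCosines (M.edgeLength r i j) (M.edgeLength r i k) (M.edgeLength r j k)) := rfl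

theorem angle_smul {s : ℝ} (hs : 0 < s) (r : V → ℝ) (i j k : V) :
    M.angle (fun v => s * r v) i j k = M.angle r i j k := by
  simp only [angle_eq_arccos, edgeLength_eq_circleDist, circleDist_mul hs.le, lawOfCosines]
  congr 1
  rw [show ∀ a b c : ℝ, (s * a) ^ 2 + (s * b) ^ 2 - (s * c) ^ 2 = s ^ 2 * (a ^ 2 + b ^ 2 - c ^ 2)
    by intros; ring, show ∀ a b : ℝ, 2 * (s * a) * (s * b) = s ^ 2 * (2 * a * b) by intros; ring,
    mul_div_mul_left _ _ (by positivity)]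

variable [Fintype V]

theorem rotate_mem_triangles (h : ({i, j, k} : Finset V) ∈ M.triangles) :
    ({j, k, i} : Finset V) ∈ M.triangles := by
  convert h using 1
  ext
  simp only [Finset.mem_insert, Finset.mem_singleton]
  tauto

/-- The bound `Φ ≤ π / 2` enters here. Having three distinct vertices makes `{i, j}` a genuine edge.
-/
theorem cos_Φ_nonneg (h : ({i, j, k} : Finset V) ∈ M.triangles) :
    0 ≤ Real.cos (M.Φ {i, j}) := by
  rw [TriangulatedSurface.mem_triangles] at h
  have hne : i ≠ j := by
    rintro rfl
    have := Finset.card_le_two (a := i) (b := k)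
    rw [Finset.insert_eq_of_mem (by simp)] at h
    omega
  have hf : ({i, j} : Finset V) ∈ M.faces :=
    M.mem_faces_of_subset h.1 (by intro; simp; tauto) (by simp)
  have hΦ := M.Φ_mem _ hf (Finset.card_pair hne)
  exact Real.cos_nonneg_of_mem_Icc ⟨by linarith [hΦ.1, Real.pi_pos], hΦ.2⟩

theorem edgeLength_pos (hr : ∀ i, 0 < r i) (h : ({i, j, k} : Finset V) ∈ M.triangles) :
    0 < M.edgeLength r i j :=
  circleDist_pos (hr i) (hr j) (M.cos_Φ_nonneg h)

theorem edgeLength_lt_add (hr : ∀ i, 0 < r i) (h : ({i, j, k} : Finset V) ∈ M.triangles) :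
    M.edgeLength r i j < M.edgeLength r i k + M.edgeLength r j k := by
  have h2 := M.rotate_mem_triangles h
  have h3 := M.rotate_mem_triangles h2
  have := M.cos_Φ_nonneg h3
  rw [Finset.pair_comm] at this
  exact circleDist_lt_add (hr i) (hr j) (hr k) (M.cos_Φ_nonneg h2) this (Real.cos_le_one _)

/-- The side lengths of a triangle are positive and satisfy the strict triangle inequalities. -/
theorem edgeLength_triangle (hr : ∀ i, 0 < r i) (h : ({i, j, k} : Finset V) ∈ M.triangles) :
    0 < M.edgeLength r i j ∧ 0 < M.edgeLength r i k ∧ 0 < M.edgeLength r j k ∧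
      M.edgeLength r i j < M.edgeLength r i k + M.edgeLength r j k ∧
      M.edgeLength r i k < M.edgeLength r i j + M.edgeLength r j k ∧
      M.edgeLength r j k < M.edgeLength r i j + M.edgeLength r i k := by
  have h2 := M.rotate_mem_triangles h
  have h3 := M.rotate_mem_triangles h2
  have e2 := M.edgeLength_lt_add hr h2
  have e3 := M.edgeLength_lt_add hr h3
  have p3 := M.edgeLength_pos hr h3
  rw [M.edgeLength_comm r k i] at p3 e2 e3
  rw [M.edgeLength_comm r k j] at e3
  rw [M.edgeLength_comm r j i] at e2
  exact ⟨M.edgeLength_pos hr h, p3, M.edgeLength_pos hr h2, M.edgeLength_lt_add hr h,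
    by linarith, by linarith⟩

theorem angle_add_angle_add_angle (hr : ∀ i, 0 < r i)
    (h : ({i, j, k} : Finset V) ∈ M.triangles) :
    M.angle r i j k + M.angle r j k i + M.angle r k i j = Real.pi := by
  obtain ⟨h1, h2, h3, h4, h5, h6⟩ := M.edgeLength_triangle hr h
  rw [angle_eq_arccos, angle_eq_arccos, angle_eq_arccos, M.edgeLength_comm r j i,
    M.edgeLength_comm r k i, M.edgeLength_comm r k j]
  exact arccos_lawOfCosines_add_add h1 h2 h3 h4 h5 h6

/-- **Combinatorial Gauss–Bonnet formula.** -/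
theorem sum_gaussCurv (hr : ∀ i, 0 < r i) :
    ∑ i, M.gaussCurv r i = 2 * Real.pi * (M.eulerChar : ℝ) := by
  set f : V → V → V → ℝ := fun i j k =>
    if ({i, j, k} : Finset V) ∈ M.triangles then M.angle r i j k else 0 with hf
  have hrot : ∀ g : V → V → V → ℝ, ∑ i, ∑ j, ∑ k, g j k i = ∑ i, ∑ j, ∑ k, g i j k := by
    intro g
    rw [Finset.sum_comm]
    exact Finset.sum_congr rfl fun _ _ => Finset.sum_comm
  have hsum : ∑ i, ∑ j, ∑ k, (f i j k + f j k i + f k i j) =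
      6 * M.triangles.card * Real.pi := by
    rw [← M.sum_ite_mem_triangles]
    refine Finset.sum_congr rfl fun i _ => Finset.sum_congr rfl fun j _ =>
      Finset.sum_congr rfl fun k _ => ?_
    simp only [hf]
    split_ifs with h1 h2 h3 h3 h2 h3 h3
    · exact M.angle_add_angle_add_angle hr h1
    · exact absurd (M.rotate_mem_triangles h2) h3
    · exact absurd (M.rotate_mem_triangles h1) h2
    · exact absurd (M.rotate_mem_triangles h1) h2
    · exact absurd (M.rotate_mem_triangles (M.rotate_mem_triangles h2)) h1
    · exact absurd (M.rotate_mem_triangles (M.rotate_mem_triangles h2)) h1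
    · exact absurd (M.rotate_mem_triangles h3) h1
    · simp
  simp only [Finset.sum_add_distrib] at hsum
  rw [hrot f, hrot fun i j k => f j k i, hrot f] at hsum
  have hE : (M.edges.card : ℝ) * 2 = M.triangles.card * 3 := by
    exact_mod_cast M.two_mul_card_edges
  have hK : ∑ i, M.gaussCurv r i =
      2 * Real.pi * Fintype.card V - 1 / 2 * ∑ i, ∑ j, ∑ k, f i j k := by
    simp only [gaussCurv, Finset.sum_sub_distrib, ← Finset.mul_sum, Finset.sum_const,
      Finset.card_univ, nsmul_eq_mul, hf]
    ring
  rw [hK, TriangulatedSurface.eulerChar]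
  push_cast
  -- The angles total `π |F|`, and `2 |E| = 3 |F|` turns `2π |V| - π |F|` into `2π χ`.
  linear_combination -(1 / 6) * hsum + Real.pi * hE

theorem angle_le_angle {r' : V → ℝ} (hr : ∀ i, 0 < r i) (hrr : ∀ i, r i ≤ r' i)
    (hi : r i = r' i) (h : ({i, j, k} : Finset V) ∈ M.triangles) :
    M.angle r i j k ≤ M.angle r' i j k := by
  have h2 := M.rotate_mem_triangles h
  have h3 := M.cos_Φ_nonneg (M.rotate_mem_triangles h2)
  rw [Finset.pair_comm] at h3
  refine Real.antitone_arccos ?_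
  have := lawOfCosines_circleDist_anti (hr i) (hr j) (hr k) (M.cos_Φ_nonneg h2) h3
    (Real.cos_le_one _) (M.cos_Φ_nonneg h) (Real.cos_le_one _) (hrr j) (hrr k)
  simp only [← edgeLength_eq_circleDist] at this
  rwa [hi] at this

theorem contDiff_edgeLength_exp (h : ({i, j, k} : Finset V) ∈ M.triangles) :
    ContDiff ℝ 1 fun u : V → ℝ => M.edgeLength (fun v => Real.exp (u v)) i j := by
  unfold edgeLength
  refine ContDiff.sqrt (by fun_prop) fun u => ?_
  exact (circleDist_arg_pos (Real.exp_pos _) (Real.exp_pos _) (M.cos_Φ_nonneg h)).ne'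

theorem contDiff_angle_exp (h : ({i, j, k} : Finset V) ∈ M.triangles) :
    ContDiff ℝ 1 fun u : V → ℝ => M.angle (fun v => Real.exp (u v)) i j k := by
  have h2 := M.rotate_mem_triangles h
  have h3 := M.rotate_mem_triangles h2
  have c1 := M.contDiff_edgeLength_exp h
  have c2 := M.contDiff_edgeLength_exp h2
  have c3 := M.contDiff_edgeLength_exp h3
  simp only [M.edgeLength_comm _ k i] at c3
  have ht := fun u : V → ℝ => M.edgeLength_triangle (fun i => Real.exp_pos (u i)) h
  have hc : ContDiff ℝ 1 fun u : V → ℝ => lawOfCosines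
      (M.edgeLength (fun v => Real.exp (u v)) i j) (M.edgeLength (fun v => Real.exp (u v)) i k)
      (M.edgeLength (fun v => Real.exp (u v)) j k) := by
    unfold lawOfCosines
    refine ContDiff.div (((c1.pow 2).add (c3.pow 2)).sub (c2.pow 2))
      ((contDiff_const.mul c1).mul c3) fun u => ?_
    obtain ⟨p1, p2, -⟩ := ht u
    positivity
  rw [contDiff_iff_contDiffAt]
  intro u
  obtain ⟨p1, p2, p3, q1, q2, q3⟩ := ht u
  exact ContDiffAt.comp u (Real.contDiffAt_arccos (neg_one_lt_lawOfCosines p1 p2 p3 q3).ne'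
    (lawOfCosines_lt_one p1 p2 q1 q2).ne) hc.contDiffAt

/-- The angle deficit, as a function of the logarithms of the radii, is a curvature map. -/
theorem isCurvatureMap_gaussCurv :
    IsCurvatureMap (fun u : V → ℝ => M.gaussCurv fun v => Real.exp (u v))
      (2 * Real.pi * (M.eulerChar : ℝ)) where
  contDiff := by
    rw [contDiff_pi]
    intro i
    unfold gaussCurv
    refine contDiff_const.sub (contDiff_const.mul (ContDiff.sum fun j _ =>
      ContDiff.sum fun k _ => ?_))
    split_ifs with h
    · exact M.contDiff_angle_exp h
    · exact contDiff_const
  le_of_le := by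
    intro u v i huv hi
    unfold gaussCurv
    refine sub_le_sub_left (mul_le_mul_of_nonneg_left ?_ (by norm_num)) _
    refine Finset.sum_le_sum fun j _ => Finset.sum_le_sum fun k _ => ?_
    split_ifs with h
    · exact M.angle_le_angle (fun _ => Real.exp_pos _) (fun w => Real.exp_le_exp.2 (huv w))
        (by rw [hi]) h
    · exact le_rfl
  add_const := by
    intro u c
    funext i
    have : (fun v => Real.exp (u v + c)) = fun v => Real.exp c * Real.exp (u v) := by
      funext v
      rw [Real.exp_add, mul_comm]
    simp only [this, gaussCurv, M.angle_smul (Real.exp_pos c)]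
  sum_eq := fun u => M.sum_gaussCurv fun _ => Real.exp_pos _

end

end WeightedTriangulatedSurface

/-! ### Translation between radii and their logarithms, and the theorem. -/

namespace WeightedTriangulatedSurface

variable {V : Type*} [Fintype V] (M : WeightedTriangulatedSurface V)

/-- The velocity of the logarithms of the radii under the normalized combinatorial Ricci flow. -/
noncomputable def logFlowField : (V → ℝ) → V → ℝ :=
  logRicciField (fun u : V → ℝ => M.gaussCurv fun v => Real.exp (u v))
    (2 * Real.pi * (M.eulerChar : ℝ))

theorem curvDensity_eq_rCurv (u : V → ℝ) (i : V) :
    curvDensity (fun u : V → ℝ => M.gaussCurv fun v => Real.exp (u v)) u i =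
      M.rCurv (fun v => Real.exp (u v)) i := by
  rw [curvDensity, rCurv, Real.exp_neg, div_eq_mul_inv, ← Real.exp_nat_mul]
  norm_num

theorem logFlowField_eq (u : V → ℝ) (i : V) : M.logFlowField u i =
    (M.rAv (fun v => Real.exp (u v)) - M.rCurv (fun v => Real.exp (u v)) i) / 2 := by
  rw [logFlowField, logRicciField, curvDensity_eq_rCurv, avgDensity, rAv]
  simp only [← Real.exp_nat_mul, Nat.cast_ofNat]

/-- Integral curves of the logarithmic field give solutions of the flow. -/
theorem isNormalizedRicciFlowOn_exp {u : ℝ → V → ℝ} {I : Set ℝ}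
    (hu : ∀ t ∈ I, HasDerivWithinAt u (M.logFlowField (u t)) I t) :
    M.IsNormalizedRicciFlowOn (fun t v => Real.exp (u t v)) I := by
  intro t ht i
  refine ⟨Real.exp_pos _, ?_⟩
  refine ((hasDerivWithinAt_pi.1 (hu t ht) i).exp.pow 2).congr_deriv ?_
  rw [logFlowField_eq]
  push_cast
  ring

/-- The logarithms of a solution of the flow form an integral curve of the logarithmic field. -/
theorem IsNormalizedRicciFlowOn.hasDerivWithinAt_log {M : WeightedTriangulatedSurface V}
    {r : ℝ → V → ℝ} {I : Set ℝ} (hr : M.IsNormalizedRicciFlowOn r I) {t : ℝ} (ht : t ∈ I) :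
    HasDerivWithinAt (fun t v => Real.log (r t v))
      (M.logFlowField fun v => Real.log (r t v)) I t := by
  rw [hasDerivWithinAt_pi]
  intro i
  obtain ⟨hpos, hd⟩ := hr t ht i
  -- The flow prescribes the derivative of `r²` only. The identity holds for every real number, so
  -- positivity outside `I` is not needed.
  have hlog : ∀ s, Real.log (r s i) = Real.log (r s i ^ 2) / 2 := fun s => by
    rw [Real.log_pow]
    push_cast
    ring
  have hexp : (fun v => Real.exp (Real.log (r t v))) = r t :=
    funext fun v => Real.exp_log (hr t ht v).1
  change HasDerivWithinAt (fun s => Real.log (r s i)) _ I t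
  rw [funext hlog]
  refine ((hd.log (pow_pos hpos 2).ne').div_const 2).congr_deriv ?_
  rw [logFlowField_eq, hexp]
  have := hpos.ne'
  field_simp

end WeightedTriangulatedSurface

/-- The coordinatewise exponential preserves exponential convergence. -/
theorem exists_norm_exp_sub_le {V : Type*} [Fintype V] {u : ℝ → V → ℝ} {x : V → ℝ} {C a : ℝ}
    (hC : 0 < C) (ha : 0 < a) (hu : ∀ t ≥ (0 : ℝ), ‖u t - x‖ ≤ C * Real.exp (-a * t)) :
    ∃ D > (0 : ℝ), ∀ t ≥ (0 : ℝ),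
      ‖(fun v => Real.exp (u t v)) - fun v => Real.exp (x v)‖ ≤ D * Real.exp (-a * t) := by
  have hsm : ContDiff ℝ 1 fun (y : V → ℝ) v => Real.exp (y v) := by
    rw [contDiff_pi]
    intro i
    fun_prop
  obtain ⟨L, hL⟩ := LocallyLipschitzOn.exists_lipschitzOnWith_of_compact
    (isCompact_closedBall x C) hsm.locallyLipschitz.locallyLipschitzOn
  refine ⟨(L + 1) * C, by positivity, fun t ht => ?_⟩
  have hmem : u t ∈ Metric.closedBall x C := by
    rw [mem_closedBall_iff_norm]
    refine (hu t ht).trans (mul_le_of_le_one_right hC.le ?_)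
    rw [Real.exp_le_one_iff, neg_mul, neg_nonpos]
    positivity
  have h := hL.norm_sub_le hmem (Metric.mem_closedBall_self hC.le)
  calc _ ≤ L * ‖u t - x‖ := h
    _ ≤ (L + 1) * (C * Real.exp (-a * t)) := by
      gcongr
      · linarith
      · exact hu t ht
    _ = _ := by ring

theorem mainTheorem5 {V : Type*} [Fintype V] [Nonempty V] (M : WeightedTriangulatedSurface V)
    (r₀ : V → ℝ) (hr₀ : ∀ i, 0 < r₀ i) (hR : ∀ i, M.rCurv r₀ i < 0) :
    ∃ rstar : V → ℝ, (∀ i, 0 < rstar i) ∧ (∃ c : ℝ, c < 0 ∧ ∀ i, M.rCurv rstar i = c) ∧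
      ∃ r : ℝ → V → ℝ, r 0 = r₀ ∧ M.IsNormalizedRicciFlowOn r (Set.Ici 0) ∧
        (∀ (T : ℝ) (s : ℝ → V → ℝ), s 0 = r₀ → M.IsNormalizedRicciFlowOn s (Set.Ico 0 T) →
          ∀ t ∈ Set.Ico 0 T, s t = r t) ∧
        ∃ C > (0 : ℝ), ∃ a > (0 : ℝ), ∀ t ≥ (0 : ℝ), ‖r t - rstar‖ ≤ C * Real.exp (-a * t) := by
  have hK := M.isCurvatureMap_gaussCurv
  have hexp : (fun v => Real.exp (Real.log (r₀ v))) = r₀ := funext fun v => Real.exp_log (hr₀ v)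
  obtain ⟨x, ⟨c, hc, hxc⟩, u, hu0, hu, C, hC, a, ha, hconv⟩ :=
    hK.exists_flow (u₀ := fun v => Real.log (r₀ v)) fun i => by
      rw [M.curvDensity_eq_rCurv, hexp]
      exact hR i
  obtain ⟨D, hD, hDconv⟩ := exists_norm_exp_sub_le hC ha hconv
  refine ⟨fun v => Real.exp (x v), fun _ => Real.exp_pos _,
    ⟨c, hc, fun i => (M.curvDensity_eq_rCurv x i).symm.trans (hxc i)⟩,
    fun t v => Real.exp (u t v), by simp only [hu0, hexp], M.isNormalizedRicciFlowOn_exp hu, ?_,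
    D, hD, a, ha, hDconv⟩
  intro T s hs0 hs t ht
  -- Uniqueness is applied on compact intervals `[0, t]` with `t < T`, since `s` is not controlled
  -- at `T`.
  have hsub : Icc 0 t ⊆ Ico 0 T := fun y hy => ⟨hy.1, hy.2.trans_lt ht.2⟩
  have heq := hK.contDiff_logRicciField.eqOn_Icc_of_hasDerivWithinAt (T := t)
    (fun y hy => (hs.hasDerivWithinAt_log (hsub hy)).mono hsub)
    (fun y hy => (hu y hy.1).mono Icc_subset_Ici_self) (by rw [hs0, hu0]) ⟨ht.1, le_rfl⟩
  funext v
  simp only [← heq, Real.exp_log (hs t ht v).1]
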